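/- **Setting.** Let $N$ (buyers) and $M$ (goods) be finite sets, $s\in\mathbb Z_+^M$ a supply vector and $[\mathbf 0,s]_{\mathbb Z}=\{x\in\mathbb Z_+^M: x\le s\}$. Each buyer $i\in N$ has a valuation $v_i:[\mathbf 0,s]_{\mathbb Z}\to\mathbb R_+$ with $v_i(\mathbf 0)=0$ that is monotone and $\mathrm M^\natural$-concave: for all $x,x'\in[\mathbf 0,s]_{\mathbb Z}$ and $j$ with $x_j>x'_j$, either $v_i(x)+v_i(x')\le v_i(x-\chi_j)+v_i(x'+\chi_j)$, or there is $k$ with $x_k<x'_k$ and $v_i(x)+v_i(x')\le v_i(x-\chi_j+\chi_k)+v_i(x'+\chi_j-\chi_k)$. For $i\in N$, $j\in M$ the payment function $q_{ij}:\mathbb R_+\to\mathbb R_+$ is continuous, piecewise linear and strictly increasing, with $q_{ij}(0)=0$, and takes the value $v_i(\chi_j)$ if $s_j\ge 1$; $q'_{ij}$ denotes its right derivative. Fix a price vector $p\in\mathbb R_+^M$. The demand set of buyer $i$ is $D_i=\operatorname{arg\,max}\{v_i(x)-\sum_{j}q_{ij}(p_j)x_j : x\in[\mathbf 0,s]_{\mathbb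 Z}\}$, and $\check D_i$ is the set of its minimal elements. Write $x(S)=\sum_{j\in S}x_j$ and, for $S\subseteq M$, put $$\check\rho_i(S)=\max_{x\in\check D_i}x(S),\qquad \mu_i(S)=\min_{x\in D_i}x(S),\qquad \mathcal O(S)=\sum_{i\in N}\mu_i(S)-s(S),$$ and $P(\check\rho_i)=\{x\in\mathbb Z_+^M: x(S)\le\check\rho_i(S)\ \forall S\subseteq M\}$. The minimal maximally over-demanded set $X^*$ is the least (with respect to inclusion) maximizer of $\mathcal O$. Let $w_{ij}=1-\gamma\log q'_{ij}(p_j)$, where $\gamma>0$ is "sufficiently small", and consider $$(P_2)\quad \max\Bigl\{\sum_{i,j}w_{ij}x_{ij} : x_i\in P(\check\rho_i)\ (i\in N),\ \sum_{i}x_i\le s\Bigr\},$$ $$(D_2)\quad \min_{z\ge \mathbf 0}\mathcal L(z),\qquad \mathcal L(z)=\sum_{i}\max_{x\in P(\check\rho_i)}\sum_{j}(w_{ij}-z_j)x_j+\sum_{j}s_jz_j .$$ These are understood in either of two ways. *Symbolically*: the numbers are formal expressions $a+\gamma b$ with $a,b\in\mathbb R$, i.e. pairs $(a,b)$ added componentwise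 and compared lexicographically, and $z$ ranges over the vectors with entries $\ge 0$ of this kind. *Numerically*: $\gamma$ is a positive real number and $z$ ranges over $\mathbb R_+^M$. **Theorem.** The set $X^*$ exists, and there is a vector $t\in\mathbb R^M$ such that the following holds symbolically and also, with the same $X^*$ and $t$, numerically for all $\gamma\in(0,\gamma_0)$, for some $\gamma_0>0$ (depending on the market and on $p$): (i) The set of minimizers of $(D_2)$ is a lattice, i.e. it is closed under componentwise minimum and maximum, and it has a least element $z^*$ (so $z^*$ is its unique minimal element). (ii) $(P_2)$ and $(D_2)$ attain their optimal values, and these coincide. (iii) $z^*=\chi_{X^*}+\gamma t$. -/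

import Mathlib

open scoped BigOperators

namespace FrictionAuction

/-- `f` is piecewise linear (affine on pieces) on `[0, ∞)`: there is a set `B` of breakpoints,
finitely many in each bounded interval, such that `f` is affine on every closed interval whose
interior contains no breakpoint. -/
def PiecewiseLinear (f : ℝ → ℝ) : Prop :=
  ∃ B : Set ℝ, (∀ R : ℝ, (B ∩ Set.Icc 0 R).Finite) ∧
    ∀ a b : ℝ, 0 ≤ a → a < b → Disjoint (Set.Ioo a b) B →
      ∃ c d : ℝ, ∀ r ∈ Set.Icc a b, f r = c * r + d

/-- `M♮`-concavity of a valuation on the integer box `[0, s]` (equivalently, of its extension by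
`-∞` outside the box: all bundles below lie in the box, and no subtraction is truncated).
The first alternative is the case of the exchange with the zero vector. -/
def MNaturalConcave {M : Type*} [DecidableEq M] (s : M → ℕ) (v : (M → ℕ) → ℝ) : Prop :=
  ∀ x ≤ s, ∀ y ≤ s, ∀ j, y j < x j →
    v x + v y ≤ v (x - Pi.single j 1) + v (y + Pi.single j 1) ∨
    ∃ k, x k < y k ∧
      v x + v y ≤ v (x - Pi.single j 1 + Pi.single k 1) + v (y + Pi.single j 1 - Pi.single k 1)

/-- The market: buyers `N`, goods `M`, supply `s`, valuations `v i` (only their values on the box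
`[0, s]` matter), and payment functions `q i j` (only their values on `[0, ∞)` matter). -/
structure Market (N M : Type*) [DecidableEq M] where
  s : M → ℕ
  v : N → (M → ℕ) → ℝ
  q : N → M → ℝ → ℝ
  v_zero : ∀ i, v i 0 = 0
  v_mono : ∀ i, MonotoneOn (v i) (Set.Iic s)
  v_concave : ∀ i, MNaturalConcave s (v i)
  q_continuous : ∀ i j, ContinuousOn (q i j) (Set.Ici 0)
  q_piecewise : ∀ i j, PiecewiseLinear (q i j)
  q_strictMono : ∀ i j, StrictMonoOn (q i j) (Set.Ici 0)
  q_zero : ∀ i j, q i j 0 = 0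
  q_attains : ∀ i j, 1 ≤ s j → ∃ r, 0 ≤ r ∧ q i j r = v i (Pi.single j 1)

/-! ### Polymatroids and linear optimization over them -/

/-- The (integral) polymatroid `P(ρ)` of a set function `ρ`. -/
def polymatroid {M : Type*} (ρ : Finset M → ℕ) : Set (M → ℕ) :=
  {x | ∀ S : Finset M, ∑ j ∈ S, x j ≤ ρ S}

theorem polymatroid_finite {M : Type*} [Fintype M] (ρ : Finset M → ℕ) :
    (polymatroid ρ).Finite := by
  classical
  refine (Set.finite_Iic (fun j : M => ρ {j})).subset fun x hx j => ?_
  simpa using hx {j}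

theorem polymatroid_toFinset_nonempty {M : Type*} [Fintype M] (ρ : Finset M → ℕ) :
    (polymatroid_finite ρ).toFinset.Nonempty :=
  ⟨0, by simp [polymatroid]⟩

section Optimization

variable {N M K : Type*} [Fintype N] [Fintype M] [AddCommGroup K] [LinearOrder K]

/-- `max {∑ j, c j * x j | x ∈ P(ρ)}`, for coefficients in a linearly ordered abelian group. -/
noncomputable def polymatroidMax (ρ : Finset M → ℕ) (c : M → K) : K :=
  (polymatroid_finite ρ).toFinset.sup' (polymatroid_toFinset_nonempty ρ)
    (fun x => ∑ j, x j • c j)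

/-- Feasible tuples `(x_i)_i` of the polymatroid sum problem. -/
def primalFeasible (ρ : N → Finset M → ℕ) (s : M → ℕ) : Set (N → M → ℕ) :=
  {x | (∀ i, x i ∈ polymatroid (ρ i)) ∧ ∀ j, ∑ i, x i j ≤ s j}

/-- The objective `∑ i, ∑ j, w i j * x i j` of the weighted polymatroid sum problem. -/
def primalValue (w : N → M → K) (x : N → M → ℕ) : K :=
  ∑ i, ∑ j, x i j • w i j

/-- The dual objective
`L(z) = ∑ i, max {∑ j, (w i j - z j) * x j | x ∈ P(ρ i)} + ∑ j, s j * z j`. -/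
noncomputable def dualValue (ρ : N → Finset M → ℕ) (s : M → ℕ) (w : N → M → K) (z : M → K) : K :=
  ∑ i, polymatroidMax (ρ i) (fun j => w i j - z j) + ∑ j, s j • z j

/-- The set of minimizers of the dual objective over all `z ≥ 0`. -/
def dualMinimizers (ρ : N → Finset M → ℕ) (s : M → ℕ) (w : N → M → K) : Set (M → K) :=
  {z | 0 ≤ z ∧ ∀ z', 0 ≤ z' → dualValue ρ s w z ≤ dualValue ρ s w z'}

end Optimization

/-! ### Demand -/

namespace Market

variable {N M : Type*} [Fintype M] [DecidableEq M] (E : Market N M)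

/-- Utility of buyer `i` for the bundle `x` at prices `p`. -/
def utility (i : N) (p : M → ℝ) (x : M → ℕ) : ℝ :=
  E.v i x - ∑ j, E.q i j (p j) * (x j : ℝ)

/-- The demand set `D_i(p)`. -/
def demand (i : N) (p : M → ℝ) : Set (M → ℕ) :=
  {x | x ≤ E.s ∧ ∀ y ≤ E.s, E.utility i p y ≤ E.utility i p x}

/-- The set of minimal elements of the demand set. -/
def minDemand (i : N) (p : M → ℝ) : Set (M → ℕ) :=
  {x | Minimal (· ∈ E.demand i p) x}

theorem demand_finite (i : N) (p : M → ℝ) : (E.demand i p).Finite :=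
  (Set.finite_Iic E.s).subset fun _ hx => hx.1

theorem demand_nonempty (i : N) (p : M → ℝ) : (E.demand i p).Nonempty := by
  obtain ⟨x, hx, h⟩ := Set.exists_max_image _ (E.utility i p) (Set.finite_Iic E.s) 
    ⟨0, Set.mem_Iic.2 zero_le⟩
  exact ⟨x, hx, h⟩

theorem minDemand_nonempty (i : N) (p : M → ℝ) : (E.minDemand i p).Nonempty := by
  obtain ⟨x, hx⟩ := (E.demand_finite i p).exists_minimal (E.demand_nonempty i p)
  exact ⟨x, hx⟩

/-- The rank function of the minimal demand set: `S ↦ max {x(S) | x minimal demand bundle}`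
(see `rank_isGreatest`). -/
noncomputable def rank (p : M → ℝ) (i : N) (S : Finset M) : ℕ :=
  sSup ((fun x : M → ℕ => ∑ j ∈ S, x j) '' E.minDemand i p)

theorem rank_isGreatest (p : M → ℝ) (i : N) (S : Finset M) :
    IsGreatest ((fun x : M → ℕ => ∑ j ∈ S, x j) '' E.minDemand i p) (E.rank p i S) := by
  have hf : (E.minDemand i p).Finite := (E.demand_finite i p).subset fun _ hx => hx.1
  exact ⟨Nat.sSup_mem ((E.minDemand_nonempty i p).image _) (hf.image _).bddAbove,
    fun _ ha => le_csSup (hf.image _).bddAbove ha⟩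

/-- The requirement function: `X ↦ min {x(X) | x ∈ D_i(p)}` (see `requirement_isLeast`). -/
noncomputable def requirement (p : M → ℝ) (i : N) (X : Finset M) : ℕ :=
  sInf ((fun x : M → ℕ => ∑ j ∈ X, x j) '' E.demand i p)

theorem requirement_isLeast (p : M → ℝ) (i : N) (X : Finset M) :
    IsLeast ((fun x : M → ℕ => ∑ j ∈ X, x j) '' E.demand i p) (E.requirement p i X) :=
  ⟨Nat.sInf_mem ((E.demand_nonempty i p).image _), fun _ ha => Nat.sInf_le ha⟩

/-- The over-demand function `X ↦ ∑ i, μ_i(X; p) - s(X)`. -/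
noncomputable def overDemand [Fintype N] (p : M → ℝ) (X : Finset M) : ℤ :=
  ∑ i, (E.requirement p i X : ℤ) - ∑ j ∈ X, (E.s j : ℤ)

/-- The maximizers of the over-demand function. -/
def maxOverDemanded [Fintype N] (p : M → ℝ) : Set (Finset M) :=
  {X | ∀ Y, E.overDemand p Y ≤ E.overDemand p X}

/-- The right derivative of the payment function `q i j` at `r`. -/
noncomputable def rightDeriv (i : N) (j : M) (r : ℝ) : ℝ :=
  derivWithin (E.q i j) (Set.Ioi r) r

/-- The weights `1 - γ log q'_ij(p_j)` for a real number `γ`. -/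
noncomputable def weight (p : M → ℝ) (γ : ℝ) (i : N) (j : M) : ℝ :=
  1 - γ * Real.log (E.rightDeriv i j (p j))

/-- The weights `1 - γ log q'_ij(p_j)` with symbolic `γ`: the number `a + γ b` is the pair
`(a, b)`, added componentwise and compared lexicographically. -/
noncomputable def lexWeight (p : M → ℝ) (i : N) (j : M) : ℝ ×ₗ ℝ :=
  toLex (1, -Real.log (E.rightDeriv i j (p j)))

end Market

end FrictionAuction

/-!
The dual problem is read as a search for equilibrium prices, over an arbitrary linearly ordered
abelian group `K`; the cases `K = ℝ ×ₗ ℝ` and `K = ℝ` are the symbolic and the numerical one.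

By `M♮`-concavity, the minimal demand bundles of a buyer all have the same size and form an
M-convex set, so that the rank functions are normalized, monotone and submodular
(`Market.isRankFunction_rank`), and the requirement function is the dual of the rank function
(`Market.requirement_add_rank_compl`).

Adding one coordinate turns the polymatroids into base polytopes, and a seller with weight zero
turns the supply constraint into an equation. For an optimal allocation, the exchange graph, whose
arcs are the feasible one-unit exchanges of the agents, has no closed walk of positive weight
(`closed_walk_nonpos`). Hence longest walks from the added coordinate define a potential
(`exists_potential`), and a potential is the same thing as a vector of prices that satisfies
complementary slackness (`isEquilibrium_iff`). So strong duality holds with integral optimal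
allocations, the dual minimizers are the solutions of a system of difference constraints and form a
lattice, and the least one is given by longest walks (`duality_of_isEquilibrium`).

A homomorphism `φ : K → K'` sends an equilibrium that is attained by walks to another such
equilibrium as soon as it preserves the sign of finitely many elements. For evaluation `a + γ b` of
symbolic numbers at a small `γ > 0` this gives the numerical claim with the same vector `t`. For
`γ = 0` it shows that the first components of the least symbolic prices are the least prices for
unit weights. Those are zero or one (`eq_indicator_of_isLeast`), and at zero-one vectors the dual
objective for unit weights is a constant minus over-demand (`Market.dualValue_indicator`), so they
are the indicator of the minimal maximally over-demanded set.
-/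

namespace FrictionAuction

/-! ### Base polytopes of submodular functions -/

section BasePolytope

variable {K : Type*} [AddCommGroup K] [LinearOrder K] [IsOrderedAddMonoid K]

/-- Abel summation: a signed weighting `d` that is nonnegative on all upper level sets of `c`
inside `A` pairs nonnegatively with `c - m`, for any lower bound `m` of `c` on `A`. -/
theorem sum_zsmul_sub_nonneg {V : Type*} {c : V → K} {d : V → ℤ} (A : Finset V) :
    (∀ S ⊆ A, (∀ j ∈ S, ∀ k ∈ A, k ∉ S → c k < c j) → 0 ≤ ∑ v ∈ S, d v) →
    ∀ m, (∀ v ∈ A, m ≤ c v) → 0 ≤ ∑ v ∈ A, d v • (c v - m) := by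
  induction A using Finset.strongInduction with
  | H A ih =>
    intro hA m hm
    rcases A.eq_empty_or_nonempty with rfl | hne
    · simp
    obtain ⟨a, ha, hmin⟩ := A.exists_min_image c hne
    have hsub : A.filter (fun v => c a < c v) ⊂ A :=
      Finset.filter_ssubset.2 ⟨a, ha, lt_irrefl _⟩
    have h1 : 0 ≤ ∑ v ∈ A.filter (fun v => c a < c v), d v • (c v - c a) := by
      refine ih _ hsub ?_ _ fun v hv => (Finset.mem_filter.1 hv).2.le
      intro S hS hup
      refine hA S (hS.trans hsub.subset) fun j hj k hk hkS => ?_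
      by_cases hak : c a < c k
      · exact hup j hj k (Finset.mem_filter.2 ⟨hk, hak⟩) hkS
      · exact (not_lt.1 hak).trans_lt (Finset.mem_filter.1 (hS hj)).2
    have h2 : ∑ v ∈ A.filter (fun v => c a < c v), d v • (c v - c a) =
        ∑ v ∈ A, d v • (c v - c a) := by
      refine Finset.sum_subset hsub.subset fun v hv hv' => ?_
      have : c v = c a := le_antisymm
        (not_lt.1 fun h => hv' (Finset.mem_filter.2 ⟨hv, h⟩)) (hmin v hv)
      simp [this]
    have h3 : ∑ v ∈ A, d v • (c v - m) =
        ∑ v ∈ A, d v • (c v - c a) + (∑ v ∈ A, d v) • (c a - m) := by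
      rw [Finset.sum_smul, ← Finset.sum_add_distrib]
      exact Finset.sum_congr rfl fun v _ => by rw [← smul_add]; congr 1; abel
    rw [h3, ← h2]
    refine add_nonneg h1 (zsmul_nonneg (sub_nonneg.2 (hm a ha)) ?_)
    exact hA A subset_rfl fun j _ k hk hkA => absurd hk hkA

variable {V : Type*} [DecidableEq V]

/-- The move `χ_j - χ_k` of one unit from `k` to `j`. -/
def move (k j : V) : V → ℤ := Pi.single j 1 - Pi.single k 1

theorem sum_move (S : Finset V) (k j : V) :
    ∑ v ∈ S, move k j v = (if j ∈ S then 1 else 0) - (if k ∈ S then 1 else 0) := by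
  simp [move, Finset.sum_sub_distrib, Pi.single_apply]

theorem sum_add_move (S : Finset V) (x : V → ℤ) (k j : V) :
    ∑ v ∈ S, (x + move k j) v =
      ∑ v ∈ S, x v + ((if j ∈ S then 1 else 0) - (if k ∈ S then 1 else 0)) := by
  rw [← sum_move S k j, ← Finset.sum_add_distrib]
  rfl

/-- Submodularity of an integer-valued set function. -/
def Submodular (f : Finset V → ℤ) : Prop :=
  ∀ A B, f (A ∩ B) + f (A ∪ B) ≤ f A + f B

variable [Fintype V]

/-- The set of integral points of the base polytope of the set function `f`. -/
def basePolytope (f : Finset V → ℤ) : Set (V → ℤ) :=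
  {x | (∀ S, ∑ v ∈ S, x v ≤ f S) ∧ ∑ v, x v = f Finset.univ}

/-- No tight set contains `j` but not `k`. For a point `x` of the base polytope this says that
`x + χ_j - χ_k` belongs to the base polytope as well. -/
def Exchangeable (f : Finset V → ℤ) (x : V → ℤ) (k j : V) : Prop :=
  ∀ S, j ∈ S → k ∉ S → ∑ v ∈ S, x v < f S

variable {f : Finset V → ℤ} {x : V → ℤ}

theorem add_move_mem_basePolytope (hx : x ∈ basePolytope f) {k j : V}
    (h : Exchangeable f x k j) : x + move k j ∈ basePolytope f := by
  refine ⟨fun S => ?_, ?_⟩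
  · rw [sum_add_move]
    have h1 := hx.1 S
    have h2 := h S
    by_cases hj : j ∈ S <;> by_cases hk : k ∈ S <;> simp [hj, hk] at h2 ⊢ <;> omega
  · rw [sum_add_move]
    simpa using hx.2

theorem tight_inter_union (hf : Submodular f) (hx : x ∈ basePolytope f) {A B : Finset V}
    (hA : ∑ v ∈ A, x v = f A) (hB : ∑ v ∈ B, x v = f B) :
    ∑ v ∈ A ∩ B, x v = f (A ∩ B) ∧ ∑ v ∈ A ∪ B, x v = f (A ∪ B) := by
  have h1 := hf A B
  have h2 := Finset.sum_union_inter (s₁ := A) (s₂ := B) (f := x)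
  have h3 := hx.1 (A ∩ B)
  have h4 := hx.1 (A ∪ B)
  constructor <;> omega

/-- If `j` cannot be exchanged for any element of `A`, a single tight set contains `j` and
avoids `A`. -/
theorem exists_tight_disjoint (hf : Submodular f) (hx : x ∈ basePolytope f) (j : V)
    (A : Finset V) (hA : ∀ k ∈ A, ¬ Exchangeable f x k j) :
    ∃ R, ∑ v ∈ R, x v = f R ∧ j ∈ R ∧ ∀ k ∈ A, k ∉ R := by
  induction A using Finset.induction_on with
  | empty => exact ⟨Finset.univ, hx.2, by simp, by simp⟩
  | insert a A _ ih =>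
    obtain ⟨R, hR, hjR, hAR⟩ := ih fun k hk => hA k (Finset.mem_insert_of_mem hk)
    have ha := hA a (Finset.mem_insert_self _ _)
    simp only [Exchangeable, not_forall, not_lt] at ha
    obtain ⟨S, hjS, haS, hS⟩ := ha
    refine ⟨R ∩ S, (tight_inter_union hf hx hR (le_antisymm (hx.1 S) hS)).1, by simp [hjR, hjS],
      fun k hk hkR => ?_⟩
    rw [Finset.mem_inter] at hkR
    rcases Finset.mem_insert.1 hk with rfl | hk
    · exact haS hkR.2
    · exact hAR k hk hkR.1

/-- Simultaneous exchanges: several feasible moves can be carried out together if they can be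
ordered so that no tail of an earlier move can be exchanged for the head of a later one. The last
move can be carried out first, because its ends lie in a tight set that avoids all other tails, and
this does not affect the hypotheses on the other moves. -/
theorem add_sum_move_mem_basePolytope {ι L : Type*} [LinearOrder L] (hf : Submodular f)
    (k j : ι → V) (key : ι → L) (hkey : Function.Injective key) (T : Finset ι) :
    ∀ x ∈ basePolytope f, (∀ t ∈ T, Exchangeable f x (k t) (j t)) →
      (∀ a ∈ T, ∀ b ∈ T, key a < key b → ¬ Exchangeable f x (k a) (j b)) →
      x + ∑ t ∈ T, move (k t) (j t) ∈ basePolytope f := by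
  classical
  induction T using Finset.induction_on_max_value key with
  | empty => intro x hx _ _; simpa using hx
  | insert r T hr hmax ih =>
    intro x hx hfeas hinf
    have hlt : ∀ a ∈ T, key a < key r := fun a ha =>
      lt_of_le_of_ne (hmax a ha) fun h => hr (hkey h ▸ ha)
    obtain ⟨R, hR, hjR, hkR⟩ := exists_tight_disjoint hf hx (j r) (T.image k) (by
      intro v hv
      obtain ⟨a, ha, rfl⟩ := Finset.mem_image.1 hv
      exact hinf a (Finset.mem_insert_of_mem ha) r (Finset.mem_insert_self _ _) (hlt a ha))
    have hrfeas := hfeas r (Finset.mem_insert_self _ _)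
    have hkrR : k r ∈ R := by
      by_contra h
      exact (hrfeas R hjR h).ne hR
    have hx' := add_move_mem_basePolytope hx hrfeas
    -- the tightness of a set containing `R` is not affected by the move at `r`
    have hsum : ∀ S, R ⊆ S → ∑ v ∈ S, (x + move (k r) (j r)) v = ∑ v ∈ S, x v := by
      intro S hS
      rw [sum_add_move]
      simp [hS hjR, hS hkrR]
    have hR' := (hsum R subset_rfl).trans hR
    rw [Finset.sum_insert hr, ← add_assoc]
    refine ih _ hx' ?_ ?_
    · intro a ha S hjS hkS
      refine lt_of_le_of_ne (hx'.1 S) fun hS => ?_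
      have h1 := (tight_inter_union hf hx' hS hR').2
      rw [hsum _ Finset.subset_union_right] at h1
      refine (hfeas a (Finset.mem_insert_of_mem ha) (S ∪ R) ?_ ?_).ne h1
      · exact Finset.mem_union_left _ hjS
      · simp [hkS, hkR (k a) (Finset.mem_image_of_mem _ ha)]
    · intro a ha b hb hab hex
      have := hinf a (Finset.mem_insert_of_mem ha) b (Finset.mem_insert_of_mem hb) hab
      simp only [Exchangeable, not_forall, not_lt] at this
      obtain ⟨S, hjS, hkS, hS⟩ := this
      have h1 := (tight_inter_union hf hx (le_antisymm (hx.1 S) hS) hR).2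
      refine (hex (S ∪ R) (Finset.mem_union_left _ hjS) ?_).ne ?_
      · simp [hkS, hkR (k a) (Finset.mem_image_of_mem _ ha)]
      · rw [hsum _ Finset.subset_union_right, h1]

/-- Local optimality implies global optimality over a base polytope: all upper level sets of the
objective `c` are tight. -/
theorem sum_zsmul_le_of_exchangeable (hf : Submodular f) (hf0 : f ∅ = 0)
    (hx : x ∈ basePolytope f) {c : V → K} (hc : ∀ k j, Exchangeable f x k j → c j ≤ c k)
    {y : V → ℤ} (hy : y ∈ basePolytope f) : ∑ v, y v • c v ≤ ∑ v, x v • c v := by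
  have htight : ∀ S : Finset V, (∀ j ∈ S, ∀ k ∉ S, c k < c j) → ∑ v ∈ S, x v = f S := by
    intro S hS
    have key : ∀ A ⊆ S, ∃ R ⊆ S, A ⊆ R ∧ ∑ v ∈ R, x v = f R := by
      intro A
      induction A using Finset.induction_on with
      | empty => exact fun _ => ⟨∅, by simp, by simp, by simp [hf0]⟩
      | insert a A _ ih =>
        intro hAS
        obtain ⟨R, hRS, hAR, hR⟩ := ih ((Finset.subset_insert _ _).trans hAS)
        have haS := hAS (Finset.mem_insert_self _ _)
        obtain ⟨Q, hQ, haQ, hQS⟩ := exists_tight_disjoint hf hx a Sᶜ fun k hk hex =>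
          (hS a haS k (by simpa using hk)).not_ge (hc k a hex)
        refine ⟨Q ∪ R, Finset.union_subset (fun v hv => ?_) hRS, ?_,
          (tight_inter_union hf hx hQ hR).2⟩
        · by_contra hvS
          exact hQS v (by simpa using hvS) hv
        · exact Finset.insert_subset (Finset.mem_union_left _ haQ)
            (hAR.trans Finset.subset_union_right)
    obtain ⟨R, h1, h2, h3⟩ := key S subset_rfl
    rwa [h1.antisymm h2] at h3
  have hd : ∑ v, (x v - y v) = 0 := by
    rw [Finset.sum_sub_distrib, hx.2, hy.2, sub_self]
  rcases isEmpty_or_nonempty V with hV | hV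
  · simp
  obtain ⟨a, -, hmin⟩ := Finset.exists_min_image Finset.univ c Finset.univ_nonempty
  have h := sum_zsmul_sub_nonneg (c := c) (d := fun v => x v - y v) Finset.univ
    (fun S _ hS => by
      rw [Finset.sum_sub_distrib, htight S fun j hj k hk => hS j hj k (Finset.mem_univ _) hk]
      exact sub_nonneg.2 (hy.1 S)) (c a) hmin
  simp only [smul_sub, Finset.sum_sub_distrib, ← Finset.sum_smul, hd, zero_smul, sub_zero] at h
  simp only [sub_smul, Finset.sum_sub_distrib] at h
  exact sub_nonneg.1 h

end BasePolytope

/-! ### Longest walks in an exchange graph -/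

section Walks

variable {V I K : Type*} [AddCommGroup K]

/-- `Walk R W n u v c`: there is a walk with `n` arcs and total weight `c` from `u` to `v`, where
`R i` is the set of arcs of colour `i`, and an arc `(v, v')` of colour `i` has weight
`W i v' - W i v`. -/
inductive Walk (R : I → V → V → Prop) (W : I → V → K) : ℕ → V → V → K → Prop
  | nil (u : V) : Walk R W 0 u u 0
  | snoc {n : ℕ} {u v v' : V} {c : K} (i : I) :
      Walk R W n u v c → R i v v' → Walk R W (n + 1) u v' (c + (W i v' - W i v))

variable {R : I → V → V → Prop} {W : I → V → K}

theorem Walk.trans {m n : ℕ} {u v w : V} {c d : K} (h : Walk R W m u v c)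
    (h' : Walk R W n v w d) : Walk R W (m + n) u w (c + d) := by
  induction h' with
  | nil => simpa using h
  | snoc i _ hR ih => rw [← add_assoc, ← add_assoc]; exact (ih h).snoc i hR

theorem Walk.map {K' : Type*} [AddCommGroup K'] (φ : K →+ K') {n : ℕ} {u v : V} {c : K}
    (h : Walk R W n u v c) : Walk R (fun i v => φ (W i v)) n u v (φ c) := by
  induction h with
  | nil => rw [map_zero]; exact .nil _
  | snoc i _ hR ih => rw [map_add, map_sub]; exact ih.snoc i hR

/-- The weight of the first `n` arcs of the walk with vertices `p t` and colours `a t`. -/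
def pathWeight (W : I → V → K) (p : ℕ → V) (a : ℕ → I) (n : ℕ) : K :=
  ∑ t ∈ Finset.range n, (W (a t) (p (t + 1)) - W (a t) (p t))

theorem pathWeight_succ (W : I → V → K) (p : ℕ → V) (a : ℕ → I) (n : ℕ) :
    pathWeight W p a (n + 1) = pathWeight W p a n + (W (a n) (p (n + 1)) - W (a n) (p n)) :=
  Finset.sum_range_succ _ _

theorem Walk.exists_path [Nonempty I] {n : ℕ} {u v : V} {c : K} (h : Walk R W n u v c) :
    ∃ (p : ℕ → V) (a : ℕ → I), p 0 = u ∧ p n = v ∧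
      (∀ t < n, R (a t) (p t) (p (t + 1))) ∧ c = pathWeight W p a n := by
  induction h with
  | nil u => exact ⟨fun _ => u, fun _ => Classical.arbitrary I, rfl, rfl, by simp, by
      simp [pathWeight]⟩
  | @snoc n u v v' c i _ hR ih =>
    obtain ⟨p, a, h0, hn, hp, hc⟩ := ih
    refine ⟨fun t => if t ≤ n then p t else v', fun t => if t < n then a t else i, by simpa, by
      simp, fun t ht => ?_, ?_⟩
    · rcases (Nat.lt_succ_iff_lt_or_eq.1 ht) with h | rfl
      · simpa [h, h.le, Nat.succ_le_of_lt h] using hp t h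
      · simpa [hn] using hR
    · rw [pathWeight, Finset.sum_range_succ, hc, pathWeight]
      congr 1
      · refine Finset.sum_congr rfl fun t ht => ?_
        have h := Finset.mem_range.1 ht
        simp [h, h.le, Nat.succ_le_of_lt h]
      · simp [hn]

theorem walk_of_path {p : ℕ → V} {a : ℕ → I} {n : ℕ} (hp : ∀ t < n, R (a t) (p t) (p (t + 1)))
    {s t : ℕ} (hst : s ≤ t) (ht : t ≤ n) :
    Walk R W (t - s) (p s) (p t) (pathWeight W p a t - pathWeight W p a s) := by
  induction t, hst using Nat.le_induction with
  | base => simpa using Walk.nil (p s)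
  | succ t hst ih =>
    have := (ih (by omega)).snoc (a t) (hp t (by omega))
    rw [Nat.succ_sub hst]
    convert this using 1
    rw [pathWeight_succ]
    abel

theorem finite_walk_weights [Finite V] [Finite I] (u : V) (n : ℕ) :
    ∀ v, {c : K | Walk R W n u v c}.Finite := by
  induction n with
  | zero =>
    intro v
    refine (Set.finite_singleton 0).subset ?_
    rintro c ⟨⟩
    rfl
  | succ n ih =>
    intro v
    refine (Set.finite_iUnion fun w : V => Set.finite_iUnion fun i : I =>
      (ih w).image (· + (W i v - W i w))).subset ?_
    rintro c (_ | ⟨i, h, hR⟩)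
    simp only [Set.mem_iUnion]
    exact ⟨_, i, _, h, rfl⟩

variable [LinearOrder K] [IsOrderedAddMonoid K]

/-- A walk with more arcs than vertices repeats a vertex; cutting out the closed part does not
decrease its weight. -/
theorem exists_short_walk [Fintype V] [Nonempty I]
    (hclosed : ∀ n v c, Walk R W n v v c → c ≤ 0) (n : ℕ) :
    ∀ {u v : V} {c : K}, Walk R W n u v c →
      ∃ m ≤ Fintype.card V, ∃ d, c ≤ d ∧ Walk R W m u v d := by
  induction n using Nat.strong_induction_on with
  | _ n ih =>
    intro u v c h
    by_cases hn : n ≤ Fintype.card V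
    · exact ⟨n, hn, c, le_rfl, h⟩
    obtain ⟨p, a, rfl, rfl, hp, rfl⟩ := h.exists_path
    obtain ⟨s, hs, t, ht, hst, hpst⟩ : ∃ s < n, ∃ t < n, s < t ∧ p s = p t := by
      obtain ⟨s, hs, t, ht, hne, heq⟩ := Finset.exists_ne_map_eq_of_card_lt_of_maps_to
        (s := Finset.range n) (t := Finset.univ) (f := p) (by simpa using hn) (by simp)
      rw [Finset.mem_range] at hs ht
      rcases lt_or_gt_of_ne hne with h | h
      · exact ⟨s, hs, t, ht, h, heq⟩
      · exact ⟨t, ht, s, hs, h, heq.symm⟩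
    have h1 := walk_of_path (W := W) hp (Nat.zero_le s) hs.le
    have h2 := walk_of_path (W := W) hp hst.le ht.le
    have h3 := walk_of_path (W := W) hp ht.le le_rfl
    rw [← hpst] at h2 h3
    have h2' := hclosed _ _ _ h2
    obtain ⟨m, hm, d, hd, hw⟩ := ih _ (by omega) (h1.trans h3)
    refine ⟨m, hm, d, le_trans ?_ hd, hw⟩
    have h0 : pathWeight W p a 0 = 0 := by simp [pathWeight]
    rw [h0, sub_zero]
    have := sub_nonpos.1 h2'
    calc pathWeight W p a n = pathWeight W p a t + (pathWeight W p a n - pathWeight W p a t) := by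
          abel
      _ ≤ _ := by gcongr

/-- If no closed walk has positive weight, then there is a walk of maximal weight from `u` to any
vertex reachable from `u`. -/
theorem exists_longest_walk [Fintype V] [Finite I] [Nonempty I]
    (hclosed : ∀ n v c, Walk R W n v v c → c ≤ 0) {u v : V}
    (hreach : ∃ n c, Walk R W n u v c) :
    ∃ c, (∃ n, Walk R W n u v c) ∧ ∀ n d, Walk R W n u v d → d ≤ c := by
  have hfin : (⋃ m ∈ Set.Iic (Fintype.card V), {c : K | Walk R W m u v c}).Finite :=
    (Set.finite_Iic _).biUnion fun m _ => finite_walk_weights u m v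
  have hmem : ∀ {m d}, m ≤ Fintype.card V → Walk R W m u v d →
      d ∈ ⋃ m ∈ Set.Iic (Fintype.card V), {c : K | Walk R W m u v c} := fun hm hd => by
    simp only [Set.mem_iUnion]
    exact ⟨_, hm, hd⟩
  obtain ⟨n₀, c₀, h₀⟩ := hreach
  obtain ⟨m, hm, d, -, hw⟩ := exists_short_walk hclosed _ h₀
  obtain ⟨c, hc, hmax⟩ := Set.exists_max_image _ id hfin ⟨d, hmem hm hw⟩
  simp only [Set.mem_iUnion] at hc
  obtain ⟨m', -, hc⟩ := hc
  refine ⟨c, ⟨m', hc⟩, fun n d hd => ?_⟩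
  obtain ⟨m, hm, d', hdd', hw⟩ := exists_short_walk hclosed _ hd
  exact hdd'.trans (hmax d' (hmem hm hw))

/-- `z` is a potential of the exchange graph: no arc is longer than the difference of `z`. -/
def IsPotential (R : I → V → V → Prop) (W : I → V → K) (z : V → K) : Prop :=
  ∀ i k j, R i k j → W i j - z j ≤ W i k - z k

theorem IsPotential.le_of_walk {z : V → K} (hz : IsPotential R W z) {n : ℕ} {u v : V}
    {c : K} (h : Walk R W n u v c) : c ≤ z v - z u := by
  induction h with
  | nil => simp
  | @snoc n u v v' c i _ hR ih =>
    have := add_le_add ih (hz i _ _ hR)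
    have h2 : c + (W i v' - z v') - (W i v - z v') ≤
        z v - z u + (W i v - z v) - (W i v - z v') := by
      gcongr
    calc _ = c + (W i v' - z v') - (W i v - z v') := by abel
      _ ≤ _ := h2
      _ = _ := by abel

/-- The least potential that vanishes at `u` gives each vertex the weight of a longest walk
from `u`. -/
theorem exists_potential [Fintype V] [Finite I] [Nonempty I]
    (hclosed : ∀ n v c, Walk R W n v v c → c ≤ 0) {u : V}
    (hreach : ∀ v, ∃ n c, Walk R W n u v c) :
    ∃ z : V → K, z u = 0 ∧ IsPotential R W z ∧ ∀ v, ∃ n, Walk R W n u v (z v) := by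
  choose z hz hmax using fun v => exists_longest_walk hclosed (hreach v)
  refine ⟨z, le_antisymm ?_ (hmax u 0 0 (.nil u)), fun i k j hR => ?_, hz⟩
  · obtain ⟨n, hn⟩ := hz u
    exact hclosed n u _ hn
  · obtain ⟨n, hn⟩ := hz k
    have := hmax j _ _ (hn.snoc i hR)
    rw [← sub_nonneg] at this ⊢
    calc 0 ≤ _ := this
      _ = _ := by abel

end Walks

section OptimalExchange

variable {V I K : Type*} [Fintype V] [DecidableEq V] [Fintype I]
  [AddCommGroup K] [LinearOrder K] [IsOrderedAddMonoid K]

/-- The exchange graph of an optimal allocation has no closed walk of positive weight. In a shortest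
one, chords satisfy the inequalities needed to order the arcs of each colour so that they can be
carried out simultaneously; doing so for all colours would improve the allocation. -/
theorem closed_walk_nonpos {f : I → Finset V → ℤ} {X : I → V → ℤ} {W : I → V → K}
    (hf : ∀ i, Submodular (f i)) (hX : ∀ i, X i ∈ basePolytope (f i))
    (hopt : ∀ X' : I → V → ℤ, (∀ i, X' i ∈ basePolytope (f i)) →
      (∀ v, ∑ i, X' i v = ∑ i, X i v) → ∑ i, ∑ v, X' i v • W i v ≤ ∑ i, ∑ v, X i v • W i v)
    (n : ℕ) : ∀ v c, Walk (fun i => Exchangeable (f i) (X i)) W n v v c → c ≤ 0 := by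
  classical
  induction n using Nat.strong_induction_on with
  | _ n ih =>
  intro v c hw
  by_contra! hc
  rcases isEmpty_or_nonempty I with hI | hI
  · rcases hw with _ | ⟨i, -, -⟩
    · exact lt_irrefl _ hc
    · exact hI.elim i
  obtain ⟨p, a, h0, hn, hp, rfl⟩ := hw.exists_path
  set S := pathWeight W p a with hS
  have hS0 : S 0 = 0 := by simp [hS, pathWeight]
  have hSsucc : ∀ t, S (t + 1) = S t + (W (a t) (p (t + 1)) - W (a t) (p t)) := fun t =>
    Finset.sum_range_succ _ _
  -- on an arc of colour `i`, the function `W i (p t) - S t` takes the same value at both ends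
  have harc : ∀ t, W (a t) (p (t + 1)) - S (t + 1) = W (a t) (p t) - S t := fun t => by
    rw [hSsucc]; abel
  have hseg : ∀ {s t}, s ≤ t → t ≤ n → Walk (fun i => Exchangeable (f i) (X i)) W (t - s) (p s)
      (p t) (S t - S s) := fun hst ht => walk_of_path hp hst ht
  -- simultaneous arcs are ordered by this value, and by their position on the walk in case of a tie
  let key : ℕ → K ×ₗ ℕ := fun t => toLex (W (a t) (p t) - S t, t)
  have hkey : Function.Injective key := fun s t h => congrArg (fun q => (ofLex q).2) h
  have hchord : ∀ s < n, ∀ t < n, a s = a t → key s < key t →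
      ¬ Exchangeable (f (a s)) (X (a s)) (p s) (p (t + 1)) := by
    intro s hs t ht hat hlt hex
    have ht' := harc t
    rw [← hat] at ht'
    rcases lt_or_ge s t with hst | hst
    · -- a forward chord skips a part of the walk
      have h1 := hseg (Nat.zero_le s) hs.le
      have h2 := hseg (Nat.succ_le_of_lt ht) le_rfl
      have h3 := (h1.snoc (a s) hex).trans h2
      rw [h0, hn] at h3
      have h4 := ih _ (by omega) _ _ h3
      rw [hS0] at h4
      have h5 : W (a s) (p t) - S t + S n ≤ W (a s) (p s) - S s := by
        rw [← ht', ← sub_nonpos]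
        calc _ = _ := by abel
          _ ≤ 0 := h4
      have h6 : W (a s) (p t) - S t < W (a s) (p s) - S s :=
        (lt_add_of_pos_right _ hc).trans_le h5
      rw [Prod.Lex.toLex_lt_toLex, ← hat] at hlt
      rcases hlt with h | h
      · exact h6.asymm h
      · exact h6.ne h.1.symm
    · -- a backward chord closes a part of the walk
      have hne : s ≠ t := fun h => hlt.ne (h ▸ rfl)
      have h1 := hseg (show t + 1 ≤ s by omega) hs.le
      have h4 := ih _ (by omega) _ _ (h1.snoc (a s) hex)
      have h5 : W (a s) (p t) - S t ≤ W (a s) (p s) - S s := by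
        rw [← ht', ← sub_nonpos]
        calc _ = _ := by abel
          _ ≤ 0 := h4
      rw [Prod.Lex.toLex_lt_toLex, ← hat] at hlt
      rcases hlt with h | h
      · exact h5.not_gt h
      · exact hst.not_gt h.2
  let T : I → Finset ℕ := fun i => (Finset.range n).filter (fun t => a t = i)
  have hmemT : ∀ {i t}, t ∈ T i → t < n ∧ a t = i := fun h => by simpa [T] using h
  have hX' : ∀ i, X i + ∑ t ∈ T i, move (p t) (p (t + 1)) ∈ basePolytope (f i) := fun i =>
    add_sum_move_mem_basePolytope (hf i) p (fun t => p (t + 1)) key hkey (T i) (X i) (hX i)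
      (fun t ht => (hmemT ht).2 ▸ hp t (hmemT ht).1)
      (fun s hs t ht hlt => by
        have := hchord s (hmemT hs).1 t (hmemT ht).1 ((hmemT hs).2.trans (hmemT ht).2.symm) hlt
        rwa [(hmemT hs).2] at this)
  have hle := hopt _ hX' fun v => ?_
  · have hval : ∀ i, ∑ v, (X i + ∑ t ∈ T i, move (p t) (p (t + 1))) v • W i v =
        ∑ v, X i v • W i v + ∑ t ∈ T i, (W (a t) (p (t + 1)) - W (a t) (p t)) := by
      intro i
      simp only [Pi.add_apply, add_smul, Finset.sum_add_distrib, Finset.sum_apply, Finset.sum_smul]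
      rw [Finset.sum_comm]
      congr 1
      refine Finset.sum_congr rfl fun t ht => ?_
      simp [move, sub_smul, Finset.sum_sub_distrib, Pi.single_apply, (hmemT ht).2, ite_smul]
    rw [Finset.sum_congr rfl fun i _ => hval i, Finset.sum_add_distrib,
      Finset.sum_fiberwise (Finset.range n) a] at hle
    exact hc.not_ge ((add_le_iff_nonpos_right _).1 hle)
  · simp only [Pi.add_apply, Finset.sum_add_distrib, Finset.sum_apply]
    rw [Finset.sum_fiberwise (Finset.range n) a]
    have : ∀ m, ∑ t ∈ Finset.range m, move (p t) (p (t + 1)) v =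
        (Pi.single (p m) 1 - Pi.single (p 0) 1 : V → ℤ) v := by
      intro m
      induction m with
      | zero => simp
      | succ m ih => rw [Finset.sum_range_succ, ih]; simp [move]
    rw [this, hn, h0]
    simp

end OptimalExchange

/-! ### The rank function of the minimal demand set -/

section ExchangeSets

variable {M : Type*}

section Dist

variable [Fintype M]

/-- The `ℓ₁`-distance. -/
def dist₁ (x y : M → ℕ) : ℤ := ∑ m, |(x m : ℤ) - y m|

theorem dist₁_comm (x y : M → ℕ) : dist₁ x y = dist₁ y x :=
  Finset.sum_congr rfl fun _ _ => abs_sub_comm _ _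

theorem dist₁_nonneg (x y : M → ℕ) : 0 ≤ dist₁ x y :=
  Finset.sum_nonneg fun _ _ => abs_nonneg _

end Dist

variable [DecidableEq M]

theorem sum_sub_add_single {x : M → ℕ} {j : M} (hj : 0 < x j) (k : M) (S : Finset M) :
    ∑ m ∈ S, (x - Pi.single j 1 + Pi.single k 1 : M → ℕ) m + (if j ∈ S then 1 else 0) =
      ∑ m ∈ S, x m + (if k ∈ S then 1 else 0) := by
  have h : ∀ m, (x - Pi.single j 1 + Pi.single k 1 : M → ℕ) m + (Pi.single j 1 : M → ℕ) m =
      x m + (Pi.single k 1 : M → ℕ) m := by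
    intro m
    rcases eq_or_ne m j with rfl | hm
    · simp; omega
    · simp [hm]
  have h2 := Finset.sum_congr (rfl : S = S) fun m _ => h m
  simpa [Finset.sum_add_distrib, Pi.single_apply] using h2

theorem add_sub_single_comm {y : M → ℕ} {j k : M} (hk : 0 < y k) (hjk : j ≠ k) :
    y + Pi.single j 1 - Pi.single k 1 = y - Pi.single k 1 + Pi.single j 1 := by
  funext m
  rcases eq_or_ne m k with rfl | hm
  · simp [hjk.symm]
  · simp [hm]

/-- The exchange property of (sets of integral points of) integral base polyhedra. -/
def BaseExchange (B : Set (M → ℕ)) : Prop :=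
  ∀ x ∈ B, ∀ y ∈ B, ∀ j, y j < x j → ∃ k, x k < y k ∧
    x - Pi.single j 1 + Pi.single k 1 ∈ B ∧ y + Pi.single j 1 - Pi.single k 1 ∈ B

variable [Fintype M]

/-- Exchanging towards another bundle decreases the `ℓ₁`-distance. -/
theorem dist₁_exchange_lt {x y : M → ℕ} {j k : M} (hj : y j < x j) (hk : x k < y k) :
    dist₁ (x - Pi.single j 1 + Pi.single k 1) y < dist₁ x y := by
  refine Finset.sum_lt_sum (fun m _ => ?_) ⟨j, Finset.mem_univ _, ?_⟩
  · rcases eq_or_ne m j with rfl | hm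
    · have : m ≠ k := by rintro rfl; omega
      simp [this]; rw [abs_of_nonneg, abs_of_nonneg] <;> omega
    · rcases eq_or_ne m k with rfl | hm'
      · simp [hm]; rw [abs_of_nonpos, abs_of_nonpos] <;> omega
      · simp [hm, hm']
  · have : j ≠ k := by rintro rfl; omega
    simp [this]; rw [abs_of_nonneg, abs_of_nonneg] <;> omega

/-- Two nested sets have a common maximizer in a set with the exchange property. -/
theorem BaseExchange.exists_common_max {B : Set (M → ℕ)} (hB : BaseExchange B) {r : Finset M → ℕ}
    (hr : ∀ S, IsGreatest ((fun x : M → ℕ => ∑ j ∈ S, x j) '' B) (r S)) {S T : Finset M}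
    (hST : S ⊆ T) : ∃ x ∈ B, ∑ j ∈ S, x j = r S ∧ ∑ j ∈ T, x j = r T := by
  have hle : ∀ S, ∀ x ∈ B, ∑ j ∈ S, x j ≤ r S := fun S x hx => (hr S).2 ⟨x, hx, rfl⟩
  -- maximizers for `S` and for `T` at minimal distance from each other
  have key : ∀ d : ℕ, ∀ x ∈ B, ∀ y ∈ B, ∑ j ∈ S, x j = r S → ∑ j ∈ T, y j = r T →
      (dist₁ x y).toNat = d → ∃ x ∈ B, ∑ j ∈ S, x j = r S ∧ ∑ j ∈ T, x j = r T := by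
    intro d
    induction d using Nat.strong_induction_on with
    | _ d ih =>
      intro x hx y hy hxS hyT hd
      by_cases hxT : ∑ j ∈ T, x j = r T
      · exact ⟨x, hx, hxS, hxT⟩
      have hlt : ∑ j ∈ T, x j < ∑ j ∈ T, y j := hyT ▸ lt_of_le_of_ne (hle T x hx) hxT
      obtain ⟨j, hjT, hj⟩ := Finset.exists_lt_of_sum_lt hlt
      obtain ⟨k, hk, hyB, hxB⟩ := hB y hy x hx j hj
      have hjk : j ≠ k := by rintro rfl; omega
      rw [add_sub_single_comm (by omega) hjk] at hxB
      have h0 := dist₁_nonneg x y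
      by_cases hkT : k ∈ T
      · have h1 := sum_sub_add_single (show 0 < y j by omega) k T
        have h2 := dist₁_exchange_lt hj hk
        rw [dist₁_comm _ x, dist₁_comm y] at h2
        simp only [hjT, hkT, if_true] at h1
        exact ih _ (by have := dist₁_nonneg x (y - Pi.single j 1 + Pi.single k 1); omega)
          x hx _ hyB hxS (by omega) rfl
      · have h1 := sum_sub_add_single (show 0 < x k by omega) j S
        have h2 := dist₁_exchange_lt hk hj
        have h3 := hle S _ hxB
        simp only [show k ∉ S from fun h => hkT (hST h), if_false] at h1
        exact ih _ (by have := dist₁_nonneg (x - Pi.single k 1 + Pi.single j 1) y; omega)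
          _ hxB y hy (by omega) hyT rfl
  obtain ⟨x, hx, hxS⟩ := (hr S).1
  obtain ⟨y, hy, hyT⟩ := (hr T).1
  exact key _ x hx y hy hxS hyT rfl

/-- A normalized, monotone and submodular set function with values in `ℕ`. -/
structure IsRankFunction (ρ : Finset M → ℕ) : Prop where
  empty : ρ ∅ = 0
  mono : ∀ S T, S ⊆ T → ρ S ≤ ρ T
  submodular : ∀ S T, ρ (S ∩ T) + ρ (S ∪ T) ≤ ρ S + ρ T

/-- Submodularity at `S` and `T` follows from a common maximizer for `S ∩ T` and `S ∪ T`. -/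
theorem BaseExchange.isRankFunction {B : Set (M → ℕ)} (hB : BaseExchange B) {r : Finset M → ℕ}
    (hr : ∀ S, IsGreatest ((fun x : M → ℕ => ∑ j ∈ S, x j) '' B) (r S)) : IsRankFunction r := by
  have hle : ∀ S, ∀ x ∈ B, ∑ j ∈ S, x j ≤ r S := fun S x hx => (hr S).2 ⟨x, hx, rfl⟩
  refine ⟨?_, fun S T hST => ?_, fun S T => ?_⟩
  · obtain ⟨x, -, hx⟩ := (hr ∅).1
    simpa using hx.symm
  · obtain ⟨x, hx, hxS⟩ := (hr S).1
    rw [← hxS]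
    exact (Finset.sum_le_sum_of_subset hST).trans (hle T x hx)
  · obtain ⟨x, hx, h1, h2⟩ := hB.exists_common_max hr
      (Finset.inter_subset_left.trans Finset.subset_union_left : S ∩ T ⊆ S ∪ T)
    rw [← h1, ← h2, add_comm, Finset.sum_union_inter]
    exact add_le_add (hle S x hx) (hle T x hx)

end ExchangeSets

namespace Market

variable {N M : Type*} [Fintype M] [DecidableEq M] (E : Market N M) {i : N} {p : M → ℝ}

theorem utility_add_eq {x y x' y' : M → ℕ} (h : ∀ m, x' m + y' m = x m + y m) :
    E.utility i p x' + E.utility i p y' - (E.v i x' + E.v i y') =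
      E.utility i p x + E.utility i p y - (E.v i x + E.v i y) := by
  have : ∑ j, E.q i j (p j) * (x' j : ℝ) + ∑ j, E.q i j (p j) * (y' j : ℝ) =
      ∑ j, E.q i j (p j) * (x j : ℝ) + ∑ j, E.q i j (p j) * (y j : ℝ) := by
    simp only [← Finset.sum_add_distrib, ← mul_add]
    exact Finset.sum_congr rfl fun j _ => by exact_mod_cast congrArg _ (congrArg _ (h j))
  simp only [utility]
  linarith

theorem demand_of_v_le {x y x' y' : M → ℕ} (hx : x ∈ E.demand i p) (hy : y ∈ E.demand i p)
    (h : ∀ m, x' m + y' m = x m + y m) (hx' : x' ≤ E.s) (hy' : y' ≤ E.s)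
    (hv : E.v i x + E.v i y ≤ E.v i x' + E.v i y') :
    x' ∈ E.demand i p ∧ y' ∈ E.demand i p := by
  have h1 := E.utility_add_eq (i := i) (p := p) h
  have h2 := hx.2 y' hy'
  have h3 := hy.2 x' hx'
  exact ⟨⟨hx', fun w hw => (hy.2 w hw).trans (by linarith)⟩,
    ⟨hy', fun w hw => (hx.2 w hw).trans (by linarith)⟩⟩

/-- Demand sets inherit the exchange property of the valuation. -/
theorem demand_exchange {x y : M → ℕ} (hx : x ∈ E.demand i p) (hy : y ∈ E.demand i p) {j : M}
    (hj : y j < x j) :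
    x - Pi.single j 1 ∈ E.demand i p ∨ ∃ k, x k < y k ∧
      x - Pi.single j 1 + Pi.single k 1 ∈ E.demand i p ∧
      y + Pi.single j 1 - Pi.single k 1 ∈ E.demand i p := by
  rcases E.v_concave i x hx.1 y hy.1 j hj with hv | ⟨k, hk, hv⟩
  · refine Or.inl (E.demand_of_v_le hx hy (fun m => ?_) (fun m => ?_) (fun m => ?_) hv).1
    · rcases eq_or_ne m j with rfl | hm
      · simp; omega
      · simp [hm]
    · exact (Nat.sub_le _ _).trans (hx.1 m)
    · rcases eq_or_ne m j with rfl | hm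
      · have : x m ≤ E.s m := hx.1 m; simp; omega
      · simpa [hm] using hy.1 m
  · have hjk : j ≠ k := by rintro rfl; omega
    refine Or.inr ⟨k, hk, E.demand_of_v_le hx hy (fun m => ?_) (fun m => ?_) (fun m => ?_) hv⟩
    · rcases eq_or_ne m j with rfl | hm
      · simp [hjk]; omega
      · rcases eq_or_ne m k with rfl | hm'
        · simp [hm]; omega
        · simp [hm, hm']
    · have : x m ≤ E.s m := hx.1 m
      rcases eq_or_ne m k with rfl | hm
      · have : y m ≤ E.s m := hy.1 m; simp [hjk.symm]; omega
      · exact le_trans (by simp [hm]) this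
    · have : y m ≤ E.s m := hy.1 m
      rcases eq_or_ne m j with rfl | hm
      · have : x m ≤ E.s m := hx.1 m; simp [hjk]; omega
      · exact le_trans (by simp [hm]) this

/-- All minimal demand bundles have the least possible size. -/
theorem sum_le_of_mem_minDemand {x y : M → ℕ} (hx : x ∈ E.minDemand i p)
    (hy : y ∈ E.demand i p) : ∑ j, x j ≤ ∑ j, y j := by
  have key : ∀ d : ℕ, ∀ y ∈ E.demand i p, (dist₁ y x).toNat = d → ∑ j, x j ≤ ∑ j, y j := by
    intro d
    induction d using Nat.strong_induction_on with
    | _ d ih =>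
      intro y hy hd
      by_contra! hlt
      obtain ⟨j, -, hj⟩ := Finset.exists_lt_of_sum_lt hlt
      rcases E.demand_exchange hx.1 hy hj with h | ⟨k, hk, -, h⟩
      · have h1 := hx.2 h (fun m => Nat.sub_le _ _) j
        simp at h1
        omega
      · have hjk : j ≠ k := by rintro rfl; omega
        rw [add_sub_single_comm (by omega) hjk] at h
        have h1 := sum_sub_add_single (show 0 < y k by omega) j Finset.univ
        have h2 := dist₁_exchange_lt hk hj
        have h3 := dist₁_nonneg (y - Pi.single k 1 + Pi.single j 1) x
        simp only [Finset.mem_univ, if_true] at h1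
        have := ih _ (by omega) _ h rfl
        omega
  exact key _ y hy rfl

theorem mem_minDemand_of_sum_le {x y : M → ℕ} (hx : x ∈ E.minDemand i p)
    (hy : y ∈ E.demand i p) (h : ∑ j, y j ≤ ∑ j, x j) : y ∈ E.minDemand i p := by
  refine ⟨hy, fun w hw hwy => ?_⟩
  have h1 := E.sum_le_of_mem_minDemand hx hw
  have h2 : ∑ j, w j = ∑ j, y j :=
    le_antisymm (Finset.sum_le_sum fun j _ => hwy j) (h.trans h1)
  exact fun j => ((Finset.sum_eq_sum_iff_of_le fun j _ => hwy j).1 h2 j (Finset.mem_univ j)).ge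

theorem baseExchange_minDemand (i : N) (p : M → ℝ) : BaseExchange (E.minDemand i p) := by
  intro x hx y hy j hj
  rcases E.demand_exchange hx.1 hy.1 hj with h | ⟨k, hk, h1, h2⟩
  · have h1 := hx.2 h (fun m => Nat.sub_le _ _) j
    simp at h1
    omega
  · have hjk : j ≠ k := by rintro rfl; omega
    refine ⟨k, hk, E.mem_minDemand_of_sum_le hx h1 ?_, E.mem_minDemand_of_sum_le hy h2 ?_⟩
    · have := sum_sub_add_single (show 0 < x j by omega) k Finset.univ
      simp only [Finset.mem_univ, if_true] at this
      omega
    · rw [add_sub_single_comm (by omega) hjk]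
      have := sum_sub_add_single (show 0 < y k by omega) j Finset.univ
      simp only [Finset.mem_univ, if_true] at this
      omega

theorem isRankFunction_rank (p : M → ℝ) (i : N) : IsRankFunction (E.rank p i) :=
  (E.baseExchange_minDemand i p).isRankFunction (E.rank_isGreatest p i)

theorem sum_eq_rank_univ {x : M → ℕ} (hx : x ∈ E.minDemand i p) :
    ∑ j, x j = E.rank p i Finset.univ := by
  obtain ⟨y, hy, h⟩ := (E.rank_isGreatest p i Finset.univ).1
  exact (E.sum_le_of_mem_minDemand hx hy.1).antisymm (E.sum_le_of_mem_minDemand hy hx.1)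
    |>.trans h

/-- The requirement function is the dual of the rank function: both are attained on minimal demand
bundles, which all have the same size. -/
theorem requirement_add_rank_compl (p : M → ℝ) (i : N) (S : Finset M) :
    E.requirement p i S + E.rank p i Sᶜ = E.rank p i Finset.univ := by
  apply le_antisymm
  · obtain ⟨x, hx, h⟩ := (E.rank_isGreatest p i Sᶜ).1
    rw [← h, ← E.sum_eq_rank_univ hx, ← Finset.sum_add_sum_compl S x]
    exact Nat.add_le_add_right ((E.requirement_isLeast p i S).2 ⟨x, hx.1, rfl⟩) _
  · obtain ⟨y, hy, h⟩ := (E.requirement_isLeast p i S).1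
    obtain ⟨x, hxy, hx⟩ := (E.demand_finite i p).exists_le_minimal hy
    rw [← h, ← E.sum_eq_rank_univ hx, ← Finset.sum_add_sum_compl S x]
    exact add_le_add (Finset.sum_le_sum fun j _ => hxy j)
      ((E.rank_isGreatest p i Sᶜ).2 ⟨x, hx, rfl⟩)

end Market

/-! ### Equilibria of the polymatroid sum problem -/

section Lift

variable {M : Type*}

/-- Polymatroids become base polytopes after adding the element `none`, whose coordinate makes all
coordinates sum to zero. This is the corresponding set function. -/
noncomputable def liftRank (ρ : Finset M → ℕ) (S : Finset (Option M)) : ℤ :=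
  haveI := Classical.dec (none ∈ S)
  if none ∈ S then 0 else ρ S.eraseNone

theorem liftRank_of_mem (ρ : Finset M → ℕ) {S : Finset (Option M)} (h : none ∈ S) :
    liftRank ρ S = 0 := if_pos h

theorem liftRank_of_notMem (ρ : Finset M → ℕ) {S : Finset (Option M)} (h : none ∉ S) :
    liftRank ρ S = ρ S.eraseNone := if_neg h

theorem IsRankFunction.submodular_liftRank [DecidableEq M] {ρ : Finset M → ℕ}
    (hρ : IsRankFunction ρ) : Submodular (liftRank ρ) := by
  intro A B
  have h1 := hρ.submodular A.eraseNone B.eraseNone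
  have h2 := hρ.mono (A ∩ B).eraseNone A.eraseNone
    (Finset.eraseNone.monotone Finset.inter_subset_left)
  have h3 := hρ.mono (A ∩ B).eraseNone B.eraseNone
    (Finset.eraseNone.monotone Finset.inter_subset_right)
  rw [← Finset.eraseNone_inter, ← Finset.eraseNone_union] at h1
  by_cases hA : none ∈ A <;> by_cases hB : none ∈ B <;>
    simp only [liftRank, Finset.mem_inter, Finset.mem_union, hA, hB, and_self, or_self, and_false,
      false_and, or_true, true_or, if_true, if_false] <;> omega

/-- Extension of coefficients by zero at `none`. -/
def extend {K : Type*} [Zero K] (c : M → K) (v : Option M) : K := v.elim 0 c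

variable [Fintype M]

/-- The point of the base polytope that corresponds to a point of the polymatroid. -/
def liftPoint (x : M → ℕ) (v : Option M) : ℤ := v.elim (-∑ j, (x j : ℤ)) fun j => x j

theorem sum_liftPoint (x : M → ℕ) : ∑ v, liftPoint x v = 0 := by
  simp [Fintype.sum_option, liftPoint]

theorem sum_liftPoint_of_notMem (x : M → ℕ) {S : Finset (Option M)} (h : none ∉ S) :
    ∑ v ∈ S, liftPoint x v = ∑ j ∈ S.eraseNone, (x j : ℤ) := by
  rw [Finset.sum_eraseNone]
  refine Finset.sum_congr rfl fun v hv => ?_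
  cases v
  · exact absurd hv h
  · rfl

theorem sum_liftPoint_of_mem [DecidableEq M] (x : M → ℕ) {S : Finset (Option M)} (h : none ∈ S) :
    ∑ v ∈ S, liftPoint x v = -∑ j ∈ Sᶜ.eraseNone, (x j : ℤ) := by
  rw [← sum_liftPoint_of_notMem x (by simpa using h), eq_neg_iff_add_eq_zero,
    Finset.sum_add_sum_compl, sum_liftPoint]

theorem sum_liftPoint_smul {K : Type*} [AddCommGroup K] (x : M → ℕ) (c : M → K) :
    ∑ v, liftPoint x v • extend c v = ∑ j, x j • c j := by
  simp [Fintype.sum_option, liftPoint, extend]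

theorem liftPoint_mem_basePolytope {ρ : Finset M → ℕ} {x : M → ℕ} (hx : x ∈ polymatroid ρ) :
    liftPoint x ∈ basePolytope (liftRank ρ) := by
  classical
  refine ⟨fun S => ?_, ?_⟩
  · by_cases h : none ∈ S
    · rw [sum_liftPoint_of_mem x h, liftRank_of_mem ρ h, neg_nonpos]
      exact Finset.sum_nonneg fun _ _ => Int.natCast_nonneg _
    · rw [sum_liftPoint_of_notMem x h, liftRank_of_notMem ρ h]
      exact_mod_cast hx _
  · rw [sum_liftPoint, liftRank_of_mem ρ (Finset.mem_univ _)]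

theorem exists_liftPoint_eq {ρ : Finset M → ℕ} {y : Option M → ℤ}
    (hy : y ∈ basePolytope (liftRank ρ)) : ∃ x ∈ polymatroid ρ, liftPoint x = y := by
  classical
  have hsum := hy.2
  rw [liftRank_of_mem ρ (Finset.mem_univ _)] at hsum
  have hpos : ∀ j, 0 ≤ y (some j) := fun j => by
    have h1 := hy.1 {some j}ᶜ
    rw [liftRank_of_mem ρ (by simp)] at h1
    have h2 := Finset.sum_add_sum_compl {some j} y
    rw [Finset.sum_singleton] at h2
    omega
  have hlift : liftPoint (fun j => (y (some j)).toNat) = y := by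
    funext v
    cases v with
    | none =>
      rw [Fintype.sum_option] at hsum
      have : ∀ j, ((y (some j)).toNat : ℤ) = y (some j) := fun j => Int.toNat_of_nonneg (hpos j)
      simp only [liftPoint, Option.elim, this]
      omega
    | some j => exact Int.toNat_of_nonneg (hpos j)
  refine ⟨_, fun S => ?_, hlift⟩
  have hS : none ∉ S.map Function.Embedding.some := by simp
  have h1 := hy.1 (S.map Function.Embedding.some)
  rw [← hlift, sum_liftPoint_of_notMem _ hS, liftRank_of_notMem ρ hS,
    Finset.eraseNone_map_some] at h1
  exact_mod_cast h1

theorem forall_sum_le_iff_exchangeable [DecidableEq M] {K : Type*} [AddCommGroup K] [LinearOrder K]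
    [IsOrderedAddMonoid K] {ρ : Finset M → ℕ} (hρ : IsRankFunction ρ) {x : M → ℕ}
    (hx : x ∈ polymatroid ρ) (c : M → K) :
    (∀ y ∈ polymatroid ρ, ∑ j, y j • c j ≤ ∑ j, x j • c j) ↔
      ∀ k j, Exchangeable (liftRank ρ) (liftPoint x) k j → extend c j ≤ extend c k := by
  have hmem := liftPoint_mem_basePolytope hx
  constructor
  · intro h k j hex
    obtain ⟨y, hy, hyx⟩ := exists_liftPoint_eq (add_move_mem_basePolytope hmem hex)
    have h1 := h y hy
    rw [← sum_liftPoint_smul, ← sum_liftPoint_smul, hyx] at h1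
    simpa [add_smul, Finset.sum_add_distrib, move, sub_smul, Finset.sum_sub_distrib,
      Pi.single_apply, ite_smul] using h1
  · intro h y hy
    rw [← sum_liftPoint_smul, ← sum_liftPoint_smul]
    refine sum_zsmul_le_of_exchangeable hρ.submodular_liftRank ?_ hmem h
      (liftPoint_mem_basePolytope hy)
    rw [liftRank_of_notMem ρ (Finset.notMem_empty _), Finset.eraseNone_empty, hρ.empty]
    rfl

end Lift

section Agents

variable {N M K : Type*}

/-- The rank functions of the buyers and of the seller, who is the agent `none`. The capacities of
the seller exceed the supply, so that the seller can always take back one more unit: this is what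
forces prices to be nonnegative. -/
def agentRank (ρ : N → Finset M → ℕ) (s : M → ℕ) (a : Option N) : Finset M → ℕ :=
  a.elim (fun S => ∑ j ∈ S, (s j + 1)) ρ

/-- The bundles of the buyers, and the unsold goods for the seller. -/
def agentPoint [Fintype N] (s : M → ℕ) (x : N → M → ℕ) (a : Option N) : M → ℕ :=
  a.elim (fun j => s j - ∑ i, x i j) x

/-- The weights of the buyers, and weight zero for the seller. -/
def agentWeight [Zero K] (w : N → M → K) (a : Option N) : Option M → K :=
  extend (a.elim 0 w)

/-- The exchanges that are feasible for agent `a` at the allocation `x`. -/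
def AgentArc [Fintype N] [Fintype M] (ρ : N → Finset M → ℕ) (s : M → ℕ) (x : N → M → ℕ)
    (a : Option N) : Option M → Option M → Prop :=
  Exchangeable (liftRank (agentRank ρ s a)) (liftPoint (agentPoint s x a))

/-- The prices `z` support the allocation `x`: no agent gains from a feasible exchange. -/
def IsEquilibrium [Fintype N] [Fintype M] [AddCommGroup K] [LinearOrder K]
    (ρ : N → Finset M → ℕ) (s : M → ℕ) (w : N → M → K) (x : N → M → ℕ) (z : M → K) : Prop :=
  IsPotential (AgentArc ρ s x) (agentWeight w) (extend z)

variable {ρ : N → Finset M → ℕ} {s : M → ℕ} {x : N → M → ℕ}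

theorem isRankFunction_agentRank [DecidableEq M] (hρ : ∀ i, IsRankFunction (ρ i)) (a : Option N) :
    IsRankFunction (agentRank ρ s a) := by
  cases a with
  | some i => exact hρ i
  | none =>
    refine ⟨rfl, fun S T h => Finset.sum_le_sum_of_subset h, fun S T => ?_⟩
    simp only [agentRank, Option.elim]
    rw [add_comm, Finset.sum_union_inter]

theorem agentPoint_mem [Fintype N] (hx : x ∈ primalFeasible ρ s) (a : Option N) :
    agentPoint s x a ∈ polymatroid (agentRank ρ s a) := by
  cases a with
  | some i => exact hx.1 i
  | none => exact fun S => Finset.sum_le_sum fun j _ => (Nat.sub_le _ _).trans (Nat.le_succ _)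

variable [Fintype N] [Fintype M]

theorem agentArc_seller (j : M) :
    AgentArc ρ s x none none (some j) := by
  intro S hj hS
  rw [sum_liftPoint_of_notMem _ hS, liftRank_of_notMem _ hS]
  simp only [agentRank, agentPoint, Option.elim]
  push_cast
  refine Finset.sum_lt_sum (fun j _ => ?_) ⟨j, by simpa using hj, ?_⟩ <;> omega

variable [AddCommGroup K] [LinearOrder K] [IsOrderedAddMonoid K] {w : N → M → K} {z : M → K}

theorem seller_optimal_iff {y : M → ℕ} (hy : y ≤ s) :
    (∀ y' ∈ polymatroid (fun S : Finset M => ∑ j ∈ S, (s j + 1)),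
      ∑ j, y' j • (0 - z j) ≤ ∑ j, y j • (0 - z j)) ↔ 0 ≤ z ∧ ∀ j, y j • z j = 0 := by
  classical
  simp only [zero_sub, smul_neg, Finset.sum_neg_distrib, neg_le_neg_iff]
  constructor
  · intro h
    have hz : 0 ≤ z := fun j => by
      have h1 := h (y + Pi.single j 1) fun S => Finset.sum_le_sum fun m _ => by
        have : y m ≤ s m := hy m
        rcases eq_or_ne m j with rfl | hm
        · simpa
        · simp only [Pi.add_apply, Pi.single_eq_of_ne hm]; omega
      simpa [add_smul, Finset.sum_add_distrib, Pi.single_apply, ite_smul] using h1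
    refine ⟨hz, fun j => ?_⟩
    have h0 := h 0 fun S => by simp
    simp only [Pi.zero_apply, zero_smul, Finset.sum_const_zero] at h0
    have hnn : ∀ j ∈ Finset.univ, 0 ≤ y j • z j := fun j _ => nsmul_nonneg (hz j) _
    exact (Finset.sum_eq_zero_iff_of_nonneg hnn).1 (le_antisymm h0 (Finset.sum_nonneg hnn)) j
      (Finset.mem_univ j)
  · rintro ⟨hz, h⟩ y' -
    rw [Finset.sum_congr rfl fun j _ => h j, Finset.sum_const_zero]
    exact Finset.sum_nonneg fun j _ => nsmul_nonneg (hz j) _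

/-- Equilibria are characterized by complementary slackness. -/
theorem isEquilibrium_iff [DecidableEq M] (hρ : ∀ i, IsRankFunction (ρ i))
    (hx : x ∈ primalFeasible ρ s) :
    IsEquilibrium ρ s w x z ↔
      (∀ i, ∀ y ∈ polymatroid (ρ i),
        ∑ j, y j • (w i j - z j) ≤ ∑ j, x i j • (w i j - z j)) ∧
      0 ≤ z ∧ ∀ j, (s j - ∑ i, x i j) • z j = 0 := by
  have hext : ∀ (c : M → K) v, extend c v - extend z v = extend (fun j => c j - z j) v := by
    intro c v
    cases v <;> simp [extend]
  have hagent : ∀ a (c : M → K), (∀ k j, AgentArc ρ s x a k j →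
      extend c j - extend z j ≤ extend c k - extend z k) ↔
        ∀ y ∈ polymatroid (agentRank ρ s a),
          ∑ j, y j • (c j - z j) ≤ ∑ j, agentPoint s x a j • (c j - z j) := by
    intro a c
    rw [forall_sum_le_iff_exchangeable (isRankFunction_agentRank hρ a) (agentPoint_mem hx a)]
    simp only [hext]
    rfl
  rw [IsEquilibrium, IsPotential, Option.forall, and_comm]
  refine and_congr (forall_congr' fun i => hagent (some i) (w i)) ?_
  refine (hagent none 0).trans ?_
  exact seller_optimal_iff (y := fun j => s j - ∑ i, x i j) fun j => Nat.sub_le _ _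

omit [IsOrderedAddMonoid K] in
theorem le_polymatroidMax {ρ : Finset M → ℕ} {x : M → ℕ} (hx : x ∈ polymatroid ρ) (c : M → K) :
    ∑ j, x j • c j ≤ polymatroidMax ρ c :=
  Finset.le_sup' (fun x : M → ℕ => ∑ j, x j • c j) ((Set.Finite.mem_toFinset _).2 hx)

omit [IsOrderedAddMonoid K] in
theorem polymatroidMax_le {ρ : Finset M → ℕ} {c : M → K} {b : K}
    (h : ∀ x ∈ polymatroid ρ, ∑ j, x j • c j ≤ b) : polymatroidMax ρ c ≤ b :=
  Finset.sup'_le _ _ fun x hx => h x ((Set.Finite.mem_toFinset _).1 hx)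

omit [IsOrderedAddMonoid K] in
theorem dualValue_sub_primalValue (hx : x ∈ primalFeasible ρ s) :
    dualValue ρ s w z - primalValue w x =
      ∑ i, (polymatroidMax (ρ i) (fun j => w i j - z j) - ∑ j, x i j • (w i j - z j)) +
        ∑ j, (s j - ∑ i, x i j) • z j := by
  have h1 : ∀ j, (s j - ∑ i, x i j) • z j = s j • z j - ∑ i, x i j • z j := fun j => by
    rw [eq_sub_iff_add_eq, ← Finset.sum_smul, ← add_smul, Nat.sub_add_cancel (hx.2 j)]
  simp only [h1, dualValue, primalValue, smul_sub, Finset.sum_sub_distrib]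
  rw [Finset.sum_comm (f := fun j i => x i j • z j)]
  abel

theorem slack_nonneg (hx : x ∈ primalFeasible ρ s) (i : N) :
    0 ≤ polymatroidMax (ρ i) (fun j => w i j - z j) - ∑ j, x i j • (w i j - z j) :=
  sub_nonneg.2 (le_polymatroidMax (hx.1 i) _)

theorem primalValue_le_dualValue (hx : x ∈ primalFeasible ρ s) (hz : 0 ≤ z) :
    primalValue w x ≤ dualValue ρ s w z := by
  rw [← sub_nonneg, dualValue_sub_primalValue hx]
  exact add_nonneg (Finset.sum_nonneg fun i _ => slack_nonneg hx i)
    (Finset.sum_nonneg fun j _ => nsmul_nonneg (hz j) _)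

theorem isEquilibrium_iff_dualValue_eq [DecidableEq M] (hρ : ∀ i, IsRankFunction (ρ i))
    (hx : x ∈ primalFeasible ρ s) :
    IsEquilibrium ρ s w x z ↔ 0 ≤ z ∧ dualValue ρ s w z = primalValue w x := by
  rw [isEquilibrium_iff hρ hx, ← sub_eq_zero (a := dualValue ρ s w z),
    dualValue_sub_primalValue hx]
  constructor
  · rintro ⟨h1, h2, h3⟩
    refine ⟨h2, ?_⟩
    rw [Finset.sum_eq_zero fun j _ => h3 j, add_zero]
    exact Finset.sum_eq_zero fun i _ =>
      le_antisymm (sub_nonpos.2 (polymatroidMax_le (h1 i))) (slack_nonneg hx i)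
  · rintro ⟨h2, h⟩
    have hn1 : ∀ i ∈ Finset.univ,
        0 ≤ polymatroidMax (ρ i) (fun j => w i j - z j) - ∑ j, x i j • (w i j - z j) :=
      fun i _ => slack_nonneg hx i
    have hn2 : ∀ j ∈ Finset.univ, 0 ≤ (s j - ∑ i, x i j) • z j :=
      fun j _ => nsmul_nonneg (h2 j) _
    rw [add_eq_zero_iff_of_nonneg (Finset.sum_nonneg hn1) (Finset.sum_nonneg hn2),
      Finset.sum_eq_zero_iff_of_nonneg hn1, Finset.sum_eq_zero_iff_of_nonneg hn2] at h
    exact ⟨fun i y hy => (le_polymatroidMax hy _).trans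
      (sub_eq_zero.1 (h.1 i (Finset.mem_univ i))).le, h2, fun j => h.2 j (Finset.mem_univ j)⟩

/-- Once one equilibrium is known, all dual minimizers support the same allocation. -/
theorem mem_dualMinimizers_iff [DecidableEq M] (hρ : ∀ i, IsRankFunction (ρ i))
    (hx : x ∈ primalFeasible ρ s) (hz : IsEquilibrium ρ s w x z) {z' : M → K} :
    z' ∈ dualMinimizers ρ s w ↔ IsEquilibrium ρ s w x z' := by
  have hz0 := (isEquilibrium_iff_dualValue_eq hρ hx).1 hz
  rw [isEquilibrium_iff_dualValue_eq hρ hx]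
  constructor
  · rintro ⟨h1, h2⟩
    exact ⟨h1, le_antisymm ((h2 z hz0.1).trans hz0.2.le) (primalValue_le_dualValue hx h1)⟩
  · rintro ⟨h1, h2⟩
    exact ⟨h1, fun z'' h => h2.le.trans (primalValue_le_dualValue hx h)⟩

theorem IsPotential.sup {V I : Type*} {R : I → V → V → Prop} {W : I → V → K} {z z' : V → K}
    (hz : IsPotential R W z) (hz' : IsPotential R W z') : IsPotential R W (z ⊔ z') := by
  intro i k j hR
  rw [Pi.sup_apply, Pi.sup_apply]
  rcases max_choice (z k) (z' k) with h | h <;> rw [h]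
  · exact (sub_le_sub_left le_sup_left _).trans (hz i k j hR)
  · exact (sub_le_sub_left le_sup_right _).trans (hz' i k j hR)

theorem IsPotential.inf {V I : Type*} {R : I → V → V → Prop} {W : I → V → K} {z z' : V → K}
    (hz : IsPotential R W z) (hz' : IsPotential R W z') : IsPotential R W (z ⊓ z') := by
  intro i k j hR
  rw [Pi.inf_apply, Pi.inf_apply]
  rcases min_choice (z j) (z' j) with h | h <;> rw [h]
  · exact (hz i k j hR).trans (sub_le_sub_left inf_le_left _)
  · exact (hz' i k j hR).trans (sub_le_sub_left inf_le_right _)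

omit [Fintype M] [IsOrderedAddMonoid K] in
theorem extend_sup (z z' : M → K) : extend (z ⊔ z') = extend z ⊔ extend z' := by
  funext v
  cases v <;> simp [extend]

omit [Fintype M] [IsOrderedAddMonoid K] in
theorem extend_inf (z z' : M → K) : extend (z ⊓ z') = extend z ⊓ extend z' := by
  funext v
  cases v <;> simp [extend]

/-- An equilibrium whose prices are attained by walks in the exchange graph gives the least dual
minimizer, and strong duality. -/
theorem duality_of_isEquilibrium [DecidableEq M] (hρ : ∀ i, IsRankFunction (ρ i))
    (hx : x ∈ primalFeasible ρ s) (hz : IsEquilibrium ρ s w x z)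
    (hwalk : ∀ j, ∃ n, Walk (AgentArc ρ s x) (agentWeight w) n none (some j) (z j)) :
    IsSublattice (dualMinimizers ρ s w) ∧ IsLeast (dualMinimizers ρ s w) z ∧
      ∃ opt : K, IsGreatest (primalValue w '' primalFeasible ρ s) opt ∧
        IsLeast (dualValue ρ s w '' {z | 0 ≤ z}) opt := by
  have hiff := fun z' => mem_dualMinimizers_iff hρ hx hz (z' := z')
  obtain ⟨hz0, hval⟩ := (isEquilibrium_iff_dualValue_eq hρ hx).1 hz
  refine ⟨⟨fun a ha b hb => ?_, fun a ha b hb => ?_⟩, ⟨(hiff z).2 hz, fun z' hz' j => ?_⟩,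
    primalValue w x, ⟨⟨x, hx, rfl⟩, ?_⟩, ⟨⟨z, hz0, hval⟩, ?_⟩⟩
  · rw [hiff] at *
    rw [IsEquilibrium, extend_sup]
    exact IsPotential.sup ha hb
  · rw [hiff] at *
    rw [IsEquilibrium, extend_inf]
    exact IsPotential.inf ha hb
  · obtain ⟨n, hn⟩ := hwalk j
    have h := IsPotential.le_of_walk ((hiff z').1 hz') hn
    simpa [extend] using h
  · rintro _ ⟨x', hx', rfl⟩
    exact hval ▸ primalValue_le_dualValue hx' hz0
  · rintro _ ⟨z', hz', rfl⟩
    exact primalValue_le_dualValue hx hz'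

theorem primalFeasible_finite : (primalFeasible ρ s).Finite := by
  refine (Set.Finite.pi fun i => polymatroid_finite (ρ i)).subset fun x hx i _ => hx.1 i

/-- An optimal allocation is supported by prices; the least such prices are given by longest walks
in its exchange graph. -/
theorem exists_isEquilibrium [DecidableEq M] (hρ : ∀ i, IsRankFunction (ρ i)) (s : M → ℕ)
    (w : N → M → K) :
    ∃ x ∈ primalFeasible ρ s, ∃ z : M → K, IsEquilibrium ρ s w x z ∧
      ∀ j, ∃ n, Walk (AgentArc ρ s x) (agentWeight w) n none (some j) (z j) := by
  obtain ⟨x, hx, hmax⟩ := Set.exists_max_image (primalFeasible ρ s) (primalValue w)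
    primalFeasible_finite ⟨0, fun i S => by simp, fun j => by simp⟩
  refine ⟨x, hx, ?_⟩
  have hclosed := closed_walk_nonpos (W := agentWeight w)
    (fun a => (isRankFunction_agentRank (s := s) hρ a).submodular_liftRank)
    (fun a => liftPoint_mem_basePolytope (agentPoint_mem hx a)) (by
      intro X hX hsum
      choose y hy hyX using fun a => exists_liftPoint_eq (hX a)
      have hy' : (fun i => y (some i)) ∈ primalFeasible ρ s := by
        refine ⟨fun i => hy (some i), fun j => ?_⟩
        have h := hsum (some j)
        simp only [← hyX, Fintype.sum_option] at h
        simp only [liftPoint, agentPoint, Option.elim] at h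
        have h2 := hx.2 j
        zify at h2 ⊢
        rw [Nat.cast_sub (hx.2 j)] at h
        push_cast at h
        omega
      have h1 := hmax _ hy'
      simp only [← hyX, agentWeight, sum_liftPoint_smul]
      simpa [Fintype.sum_option, agentPoint, primalValue] using h1)
  obtain ⟨z, hz0, hz, hwalk⟩ := exists_potential (R := AgentArc ρ s x) (W := agentWeight w)
    hclosed (u := none) (by
      rintro (_ | j)
      · exact ⟨0, 0, .nil none⟩
      · exact ⟨_, _, (Walk.nil none).snoc none (agentArc_seller j)⟩)
  refine ⟨fun j => z (some j), ?_, fun j => hwalk (some j)⟩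
  have : extend (fun j => z (some j)) = z := by
    funext v
    cases v <;> simp [extend, hz0]
  rw [IsEquilibrium, this]
  exact hz

end Agents

/-! ### Symbolic and numerical weights -/

section Transfer

variable {N M K K' : Type*} [Fintype N] [Fintype M] [AddCommGroup K] [LinearOrder K]
  [AddCommGroup K'] {ρ : N → Finset M → ℕ} {s : M → ℕ} {x : N → M → ℕ} {w : N → M → K} {z : M → K}

omit [Fintype N] [Fintype M] [LinearOrder K] in
theorem map_extend (φ : K →+ K') (c : M → K) (v : Option M) :
    φ (extend c v) = extend (fun j => φ (c j)) v := by
  cases v <;> simp [extend]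

omit [Fintype N] [Fintype M] [LinearOrder K] in
theorem map_agentWeight (φ : K →+ K') (w : N → M → K) (a : Option N) (v : Option M) :
    φ (agentWeight w a v) = agentWeight (fun i j => φ (w i j)) a v := by
  cases a <;> cases v <;> simp [agentWeight, extend]

omit [LinearOrder K] in
theorem walk_agentWeight_map (φ : K →+ K') {n : ℕ} {u v : Option M} {c : K}
    (h : Walk (AgentArc ρ s x) (agentWeight w) n u v c) :
    Walk (AgentArc ρ s x) (agentWeight fun i j => φ (w i j)) n u v (φ c) := by
  have := h.map φ
  simpa only [map_agentWeight] using this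

omit [LinearOrder K] in
/-- A homomorphism maps an equilibrium to an equilibrium if it maps the finitely many differences
occurring in the definition to nonnegative elements. -/
theorem isEquilibrium_map [LinearOrder K'] [IsOrderedAddMonoid K'] (φ : K →+ K')
    (h : ∀ a k j, AgentArc ρ s x a k j →
      0 ≤ φ ((agentWeight w a k - extend z k) - (agentWeight w a j - extend z j))) :
    IsEquilibrium ρ s (fun i j => φ (w i j)) x (fun j => φ (z j)) := by
  intro a k j hR
  have := h a k j hR
  simpa only [map_sub, map_agentWeight, map_extend, sub_nonneg] using this

end Transfer

/-- Evaluation of the symbolic number `a + γ b` at a real number `γ`. -/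
def evalAt (γ : ℝ) : ℝ ×ₗ ℝ →+ ℝ where
  toFun c := (ofLex c).1 + γ * (ofLex c).2
  map_zero' := by simp
  map_add' c d := by simp only [ofLex_add, Prod.fst_add, Prod.snd_add]; ring

theorem evalAt_zero_nonneg {c : ℝ ×ₗ ℝ} (hc : 0 ≤ c) : 0 ≤ evalAt 0 c := by
  have h : 0 ≤ (ofLex c).1 := by
    rcases Prod.Lex.le_iff.1 hc with h | h
    · exact h.le
    · exact h.1.le
  simpa [evalAt] using h

theorem eventually_evalAt_nonneg {c : ℝ ×ₗ ℝ} (hc : 0 ≤ c) :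
    ∀ᶠ γ in nhdsWithin (0 : ℝ) (Set.Ioi 0), 0 ≤ evalAt γ c := by
  rcases Prod.Lex.le_iff.1 hc with h | ⟨h1, h2⟩
  · have hcont : Continuous fun γ : ℝ => (ofLex c).1 + γ * (ofLex c).2 := by fun_prop
    have h0 : 0 < (ofLex c).1 + 0 * (ofLex c).2 := by simpa using h
    exact ((hcont.tendsto 0).eventually_const_lt h0).filter_mono nhdsWithin_le_nhds
      |>.mono fun γ hγ => hγ.le
  · filter_upwards [self_mem_nhdsWithin] with γ hγ
    have h1' : (ofLex c).1 = 0 := h1.symm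
    have h2' : 0 ≤ (ofLex c).2 := h2
    change 0 ≤ (ofLex c).1 + γ * (ofLex c).2
    rw [h1', zero_add]
    exact mul_nonneg (le_of_lt hγ) h2'

section UnitWeights

variable {N M : Type*} [Fintype N] [Fintype M] [DecidableEq M] {ρ : N → Finset M → ℕ} {s : M → ℕ}
  {x : N → M → ℕ} {a : M → ℝ}

omit [DecidableEq M] in
/-- For unit weights, rounding equilibrium prices (to `1` from `1` on, otherwise to `0`) gives
equilibrium prices again: net values of all agents are transformed monotonically. -/
theorem isEquilibrium_indicator (ha : IsEquilibrium ρ s (fun _ _ => (1 : ℝ)) x a) :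
    IsEquilibrium ρ s (fun _ _ => (1 : ℝ)) x (fun j => if 1 ≤ a j then 1 else 0) := by
  intro i k j hR
  have h := ha i k j hR
  revert h
  cases i <;> cases k <;> cases j <;>
    simp only [agentWeight, extend, Option.elim, Pi.zero_apply] <;>
    (try split_ifs) <;> intro h <;> linarith

/-- The least equilibrium prices for unit weights are zero or one. -/
theorem eq_indicator_of_isLeast (hρ : ∀ i, IsRankFunction (ρ i)) (hx : x ∈ primalFeasible ρ s)
    (ha : IsEquilibrium ρ s (fun _ _ => (1 : ℝ)) x a)
    (hleast : IsLeast (dualMinimizers ρ s fun _ _ => (1 : ℝ)) a) (j : M) :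
    a j = if 1 ≤ a j then 1 else 0 := by
  have h1 := hleast.2 ((mem_dualMinimizers_iff hρ hx ha).2 (isEquilibrium_indicator ha)) j
  have h2 : 0 ≤ a j := hleast.1.1 j
  dsimp only at h1
  split_ifs at h1 ⊢ <;> linarith

end UnitWeights

namespace Market

variable {N M : Type*} [Fintype N] [Fintype M] [DecidableEq M] (E : Market N M) (p : M → ℝ)

omit [Fintype N] in
theorem polymatroidMax_rank_indicator (i : N) (Y : Finset M) :
    polymatroidMax (E.rank p i) (fun j => (1 : ℝ) - if j ∈ Y then 1 else 0) = E.rank p i Yᶜ := by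
  have hsum : ∀ x : M → ℕ, ∑ j, x j • ((1 : ℝ) - if j ∈ Y then 1 else 0) =
      ((∑ j ∈ Yᶜ, x j : ℕ) : ℝ) := by
    intro x
    rw [← Finset.sum_add_sum_compl Y, Nat.cast_sum, Finset.sum_eq_zero, zero_add]
    · refine Finset.sum_congr rfl fun j hj => ?_
      simp [Finset.mem_compl.1 hj]
    · intro j hj
      simp [hj]
  apply le_antisymm
  · refine polymatroidMax_le fun x hx => ?_
    rw [hsum]
    exact_mod_cast hx Yᶜ
  · obtain ⟨x, hx, h⟩ := (E.rank_isGreatest p i Yᶜ).1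
    have hxP : x ∈ polymatroid (E.rank p i) := fun S => (E.rank_isGreatest p i S).2 ⟨x, hx, rfl⟩
    have := le_polymatroidMax hxP (fun j => (1 : ℝ) - if j ∈ Y then 1 else 0)
    rw [hsum] at this
    dsimp only at h
    rwa [h] at this

/-- Over-demand is, up to sign and a constant, the dual objective for unit weights at indicator
vectors. -/
theorem dualValue_indicator (Y : Finset M) :
    dualValue (E.rank p) E.s (fun _ _ => (1 : ℝ)) (fun j => if j ∈ Y then 1 else 0) =
      ((∑ i, (E.rank p i Finset.univ : ℤ) - E.overDemand p Y : ℤ) : ℝ) := by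
  have h : ∀ i, (E.requirement p i Y : ℝ) = E.rank p i Finset.univ - E.rank p i Yᶜ := fun i => by
    rw [← E.requirement_add_rank_compl p i Y]
    push_cast
    ring
  simp only [dualValue, polymatroidMax_rank_indicator, overDemand]
  push_cast
  simp only [h, mul_ite, nsmul_eq_mul, mul_one, mul_zero, Finset.sum_sub_distrib,
    Finset.sum_ite_mem, Finset.univ_inter]
  ring

theorem isLeast_maxOverDemanded {X : Finset M}
    (hX : IsLeast (dualMinimizers (E.rank p) E.s fun _ _ => (1 : ℝ))
      (fun j => if j ∈ X then 1 else 0)) : IsLeast (E.maxOverDemanded p) X := by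
  have hnn : ∀ Y : Finset M, (0 : M → ℝ) ≤ fun j => if j ∈ Y then 1 else 0 := fun Y j => by
    dsimp only [Pi.zero_apply]
    split_ifs <;> norm_num
  constructor
  · intro Y
    have h := hX.1.2 _ (hnn Y)
    rw [dualValue_indicator, dualValue_indicator] at h
    have h' := Int.cast_le.1 h
    omega
  · intro Y hY j hj
    have hmem : (fun j => if j ∈ Y then (1 : ℝ) else 0) ∈
        dualMinimizers (E.rank p) E.s fun _ _ => (1 : ℝ) := by
      refine ⟨hnn Y, fun z' hz' => le_trans ?_ (hX.1.2 z' hz')⟩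
      rw [dualValue_indicator, dualValue_indicator]
      have := hY X
      exact Int.cast_le.2 (by omega)
    have h := hX.2 hmem j
    by_contra hjY
    simp only [hj, hjY, if_true, if_false] at h
    linarith

omit [Fintype N] [Fintype M] in
theorem evalAt_lexWeight (γ : ℝ) : (fun i j => evalAt γ (E.lexWeight p i j)) = E.weight p γ := by
  funext i j
  simp [evalAt, lexWeight, weight, sub_eq_add_neg]

end Market

end FrictionAuction

open FrictionAuction in
theorem mainTheorem4 {N M : Type*} [Fintype N] [Fintype M] [DecidableEq M]
    (E : FrictionAuction.Market N M) (p : M → ℝ) (hp : ∀ j, 0 ≤ p j) :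
    ∃ (X : Finset M) (t : M → ℝ),
      -- `X` is the minimal maximally over-demanded set at `p`
      IsLeast (E.maxOverDemanded p) X ∧
      -- symbolic `γ`: numbers `a + γ b` are pairs with the lexicographic order
      (IsSublattice (FrictionAuction.dualMinimizers (E.rank p) E.s (E.lexWeight p)) ∧
        IsLeast (FrictionAuction.dualMinimizers (E.rank p) E.s (E.lexWeight p))
          (fun j => toLex ((if j ∈ X then 1 else 0 : ℝ), t j)) ∧
        ∃ opt : ℝ ×ₗ ℝ,
          IsGreatest (FrictionAuction.primalValue (E.lexWeight p) ''
            FrictionAuction.primalFeasible (E.rank p) E.s) opt ∧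
          IsLeast (FrictionAuction.dualValue (E.rank p) E.s (E.lexWeight p) ''
            {z | 0 ≤ z}) opt) ∧
      -- all sufficiently small real numbers `γ > 0`, with the same `t`
      ∃ γ₀ : ℝ, 0 < γ₀ ∧ ∀ γ : ℝ, 0 < γ → γ < γ₀ →
        IsSublattice (FrictionAuction.dualMinimizers (E.rank p) E.s (E.weight p γ)) ∧
        IsLeast (FrictionAuction.dualMinimizers (E.rank p) E.s (E.weight p γ))
          (fun j => (if j ∈ X then 1 else 0 : ℝ) + γ * t j) ∧
        ∃ opt : ℝ,
          IsGreatest (FrictionAuction.primalValue (E.weight p γ) ''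
            FrictionAuction.primalFeasible (E.rank p) E.s) opt ∧
          IsLeast (FrictionAuction.dualValue (E.rank p) E.s (E.weight p γ) ''
            {z | 0 ≤ z}) opt := by
  have hρ := E.isRankFunction_rank p
  obtain ⟨x, hx, z, hz, hwalk⟩ := exists_isEquilibrium hρ E.s (E.lexWeight p)
  -- walks keep their weights under every evaluation, so only the sign conditions need small `γ`
  have hwalk' : ∀ γ j, ∃ n, Walk (AgentArc (E.rank p) E.s x)
      (agentWeight fun i j => evalAt γ (E.lexWeight p i j)) n none (some j) (evalAt γ (z j)) :=
    fun γ j => (hwalk j).imp fun n hn => walk_agentWeight_map (evalAt γ) hn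
  -- at `γ = 0` the weights are one
  have hone : (fun i j => evalAt 0 (E.lexWeight p i j)) = fun _ _ => (1 : ℝ) := by
    funext i j
    simp [evalAt, Market.lexWeight]
  have hz0 : IsEquilibrium (E.rank p) E.s (fun _ _ => (1 : ℝ)) x (fun j => evalAt 0 (z j)) :=
    hone ▸ isEquilibrium_map (evalAt 0) fun a k j hR =>
      evalAt_zero_nonneg (sub_nonneg.2 (hz a k j hR))
  have hleast := (duality_of_isEquilibrium hρ hx hz0 (hone ▸ hwalk' 0)).2.1
  let X : Finset M := Finset.univ.filter fun j => 1 ≤ evalAt 0 (z j)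
  have hX : ∀ j, (if j ∈ X then (1 : ℝ) else 0) = evalAt 0 (z j) := fun j => by
    rw [eq_indicator_of_isLeast hρ hx hz0 hleast j]
    simp [X]
  have hfst : ∀ j, (ofLex (z j)).1 = if j ∈ X then (1 : ℝ) else 0 := fun j => by
    rw [hX]; simp [evalAt]
  refine ⟨X, fun j => (ofLex (z j)).2, E.isLeast_maxOverDemanded p ?_, ?_, ?_⟩
  · simpa only [hX] using hleast
  · have hzX : (fun j => toLex ((if j ∈ X then 1 else 0 : ℝ), (ofLex (z j)).2)) = z := by
      funext j
      rw [← hfst]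
      rfl
    rw [hzX]
    exact duality_of_isEquilibrium hρ hx hz hwalk
  · have hev : ∀ᶠ γ in nhdsWithin (0 : ℝ) (Set.Ioi 0), ∀ a k j, AgentArc (E.rank p) E.s x a k j →
        0 ≤ evalAt γ ((agentWeight (E.lexWeight p) a k - extend z k) -
          (agentWeight (E.lexWeight p) a j - extend z j)) := by
      simp only [Filter.eventually_all]
      exact fun a k j hR => eventually_evalAt_nonneg (sub_nonneg.2 (hz a k j hR))
    obtain ⟨γ₀, hγ₀, hsub⟩ := mem_nhdsGT_iff_exists_Ioo_subset.1 hev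
    refine ⟨γ₀, hγ₀, fun γ h0 h1 => ?_⟩
    have hzγ := isEquilibrium_map (evalAt γ) (hsub ⟨h0, h1⟩)
    have h := duality_of_isEquilibrium hρ hx hzγ (hwalk' γ)
    have hzX : (fun j => (if j ∈ X then 1 else 0 : ℝ) + γ * (ofLex (z j)).2) =
        fun j => evalAt γ (z j) := by
      funext j
      rw [← hfst]
      rfl
    rw [hzX]
    rwa [E.evalAt_lexWeight] at h
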